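/- Let $k\ge 1$ and let $\mathbf a^1,\dots,\mathbf a^k\in\mathbb R^2$ be pairwise linearly independent vectors. (i) Let $s\ge 0$ be an integer and let $f\in C^s(\mathbb R^2)$ (with $C^0=C$). If there are arbitrary functions $f_1,\dots,f_k:\mathbb R\to\mathbb R$ (no regularity is assumed) such that $f(\mathbf x)=\sum_{i=1}^k f_i(\mathbf a^i\cdot\mathbf x)$ for all $\mathbf x\in\mathbb R^2$, then there exist $g_1,\dots,g_k\in C^s(\mathbb R)$ such that $$f(\mathbf x)=\sum_{i=1}^k g_i(\mathbf a^i\cdot\mathbf x)\qquad\text{for all }\mathbf x\in\mathbb R^2 .$$ (ii) Every real bivariate polynomial $P$ of total degree at most $k-1$ can be written as $$P(\mathbf x)=\sum_{i=1}^k p_i(\mathbf a^i\cdot\mathbf x)\qquad\text{for all }\mathbf x\in\mathbb R^2,$$ where $p_1,\dots,p_k$ are real univariate polynomials of degree at most $k-1$. -/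

import Mathlib

open scoped Polynomial

/-- The sum of ridge functions `x ↦ ∑ i, g i (a i ⬝ x)` on the Euclidean space `ℝⁿ`, with
directions `a i` and arbitrary profiles `g i : ℝ → ℝ`. -/
noncomputable def ridgeSum {n k : ℕ} (a : Fin k → EuclideanSpace ℝ (Fin n))
    (g : Fin k → ℝ → ℝ) (x : EuclideanSpace ℝ (Fin n)) : ℝ :=
  ∑ i, g i (inner ℝ (a i) x)

/-- The average of `f` over the segments `[x, x + e]`. -/
noncomputable def segmentAverage {E F : Type*} [NormedAddCommGroup E] [NormedSpace ℝ E]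
    [NormedAddCommGroup F] [NormedSpace ℝ F] (e : E) (f : E → F) (x : E) : F :=
  ∫ u in (0 : ℝ)..1, f (x + u • e)

theorem hasFDerivAt_segmentAverage {E F : Type*} [NormedAddCommGroup E] [NormedSpace ℝ E]
    [ProperSpace E] [NormedAddCommGroup F] [NormedSpace ℝ F] (e : E)
    {f : E → F} {f' : E → E →L[ℝ] F} (hf' : Continuous f') (hf : ∀ x, HasFDerivAt f (f' x) x)
    (x : E) : HasFDerivAt (segmentAverage e f) (segmentAverage e f' x) x := by
  have hfc : Continuous f := continuous_iff_continuousAt.2 fun x => (hf x).continuousAt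
  obtain ⟨C, hC⟩ := ((isCompact_closedBall x 1).prod
    (isCompact_uIcc (a := (0 : ℝ)) (b := 1))).exists_bound_of_continuousOn
    (f := fun p : E × ℝ => f' (p.1 + p.2 • e)) (by fun_prop)
  refine intervalIntegral.hasFDerivAt_integral_of_dominated_of_fderiv_le
    (F := fun x u => f (x + u • e)) (F' := fun x u => f' (x + u • e)) (bound := fun _ => C)
    (Metric.closedBall_mem_nhds x one_pos) ?_ ?_ ?_ ?_ ?_ ?_
  · exact Filter.Eventually.of_forall fun y =>
      (show Continuous fun u : ℝ => f (y + u • e) by fun_prop).aestronglyMeasurable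
  · exact (show Continuous fun u : ℝ => f (x + u • e) by fun_prop).intervalIntegrable _ _
  · exact (show Continuous fun u : ℝ => f' (x + u • e) by fun_prop).aestronglyMeasurable
  · exact Filter.Eventually.of_forall fun u hu y hy =>
      hC (y, u) ⟨hy, Set.uIoc_subset_uIcc hu⟩
  · exact intervalIntegrable_const
  · exact Filter.Eventually.of_forall fun u _ y _ => (hasFDerivAt_comp_add_right (u • e)).2 (hf _)

theorem ContDiff.segmentAverage.{u} {E F : Type u} [NormedAddCommGroup E] [NormedSpace ℝ E]
    [FiniteDimensional ℝ E] [NormedAddCommGroup F] [NormedSpace ℝ F] (e : E) {s : ℕ}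
    {f : E → F} (hf : ContDiff ℝ s f) : ContDiff ℝ s (segmentAverage e f) := by
  have : ProperSpace E := FiniteDimensional.proper_real E
  induction s generalizing F with
  | zero =>
    have hc : Continuous f := hf.continuous
    refine contDiff_zero.2 ?_
    exact intervalIntegral.continuous_parametric_intervalIntegral_of_continuous'
      (f := fun x u => f (x + u • e)) (by unfold Function.uncurry; fun_prop) 0 1
  | succ s ih =>
    obtain ⟨f', hf', hd⟩ := contDiff_succ_iff_hasFDerivAt.1 (by exact_mod_cast hf)
    have := contDiff_succ_iff_hasFDerivAt.2
      ⟨_, ih hf', hasFDerivAt_segmentAverage e hf'.continuous hd⟩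
    exact_mod_cast this

theorem hasDerivAt_segmentAverage_line {E : Type*} [NormedAddCommGroup E] [NormedSpace ℝ E]
    (e : E) {f : E → ℝ} (hf : Continuous f) (x : E) (t : ℝ) :
    HasDerivAt (fun t : ℝ => segmentAverage e f (x + t • e))
      (f (x + t • e + (1 : ℝ) • e) - f (x + t • e)) t := by
  have hg : Continuous fun u : ℝ => f (x + u • e) := by fun_prop
  have key : (fun t : ℝ => segmentAverage e f (x + t • e)) =
      fun t => (∫ u in (0 : ℝ)..(t + 1), f (x + u • e)) - ∫ u in (0 : ℝ)..t, f (x + u • e) := by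
    funext t
    rw [intervalIntegral.integral_interval_sub_left (hg.intervalIntegrable _ _)
      (hg.intervalIntegrable _ _)]
    have := intervalIntegral.integral_comp_add_left (a := 0) (b := 1)
      (fun u : ℝ => f (x + u • e)) t
    rw [add_zero] at this
    rw [← this]
    simp only [segmentAverage, add_smul, add_assoc]
  have hG : ∀ t : ℝ, HasDerivAt (fun t => ∫ u in (0 : ℝ)..t, f (x + u • e)) (f (x + t • e)) t :=
    fun t => hg.integral_hasStrictDerivAt 0 t |>.hasDerivAt
  rw [key]
  have := ((hG (t + 1)).comp_add_const t 1).sub (hG t)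
  rwa [add_smul, ← add_assoc] at this

/-- `f` is annihilated by every composition of difference operators along the vectors of a list,
with arbitrary step lengths. -/
def AnnihilatedByDifferences {E : Type*} [AddCommGroup E] [Module ℝ E] :
    List E → (E → ℝ) → Prop
  | [], f => ∀ x, f x = 0
  | e :: l, f => ∀ t : ℝ, AnnihilatedByDifferences l fun x => f (x + t • e) - f x

theorem AnnihilatedByDifferences.neg {E : Type*} [AddCommGroup E] [Module ℝ E] {l : List E}
    {f : E → ℝ} (h : AnnihilatedByDifferences l f) :
    AnnihilatedByDifferences l fun x => - f x := by
  induction l generalizing f with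
  | nil => exact fun x => by simp [h x]
  | cons e l ih =>
    intro t
    convert ih (h t) using 2
    ring

theorem AnnihilatedByDifferences.intervalIntegral {E : Type*} [NormedAddCommGroup E]
    [NormedSpace ℝ E] {l : List E} {f : ℝ → E → ℝ} (hf : Continuous (Function.uncurry f))
    (h : ∀ u, AnnihilatedByDifferences l (f u)) (a b : ℝ) :
    AnnihilatedByDifferences l fun x => ∫ u in a..b, f u x := by
  induction l generalizing f with
  | nil =>
    intro x
    simp [fun u => h u x]
  | cons e l ih =>
    intro t
    have h1 (x : E) : Continuous fun u => f u x := hf.comp (by fun_prop : Continuous fun u => (u, x))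
    have := ih (f := fun u x => f u (x + t • e) - f u x) ?_ fun u => h u t
    · convert this using 2
      exact (intervalIntegral.integral_sub ((h1 _).intervalIntegrable _ _)
        ((h1 _).intervalIntegrable _ _)).symm
    · exact (hf.comp (by fun_prop : Continuous fun p : ℝ × E => (p.1, p.2 + t • e))).sub hf

theorem annihilatedByDifferences_ridgeSum {n k : ℕ} (a e : Fin k → EuclideanSpace ℝ (Fin n))
    (h : ∀ i, inner ℝ (a i) (e i) = 0) (φ : Fin k → ℝ → ℝ) :
    AnnihilatedByDifferences (List.ofFn e) (ridgeSum a φ) := by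
  induction k with
  | zero => exact fun x => by simp [ridgeSum]
  | succ k ih =>
    rw [List.ofFn_succ]
    intro t
    convert ih (fun i => a i.succ) (fun i => e i.succ) (fun i => h i.succ)
      (fun i u => φ i.succ (u + t * inner ℝ (a i.succ) (e 0)) - φ i.succ u) using 2 with x
    simp [ridgeSum, Fin.sum_univ_succ, inner_add_right, inner_smul_right, h 0,
      Finset.sum_sub_distrib]

/-- The rotation of a plane vector by a right angle. -/
noncomputable def planePerp (a : EuclideanSpace ℝ (Fin 2)) : EuclideanSpace ℝ (Fin 2) :=
  !₂[-a 1, a 0]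

theorem real_inner_plane (a b : EuclideanSpace ℝ (Fin 2)) :
    inner ℝ a b = a 0 * b 0 + a 1 * b 1 := by
  simp [PiLp.inner_apply, Fin.sum_univ_two, mul_comm]

theorem inner_planePerp (a b : EuclideanSpace ℝ (Fin 2)) :
    inner ℝ a (planePerp b) = a 1 * b 0 - a 0 * b 1 := by
  simp [planePerp, real_inner_plane]
  ring

theorem inner_planePerp_self (a : EuclideanSpace ℝ (Fin 2)) : inner ℝ a (planePerp a) = 0 := by
  rw [inner_planePerp]; ring

theorem inner_planePerp_ne_zero {a b : EuclideanSpace ℝ (Fin 2)}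
    (h : LinearIndependent ℝ ![a, b]) : inner ℝ a (planePerp b) ≠ 0 := by
  rw [inner_planePerp]
  intro h0
  rw [LinearIndependent.pair_iff] at h
  have h1 := h (b 0) (-a 0) (by ext i; fin_cases i <;> simp <;> linarith)
  have h2 := h (b 1) (-a 1) (by ext i; fin_cases i <;> simp <;> linarith)
  have h3 := h 1 0 (by ext i; fin_cases i <;> simp <;> linarith [h1.2, h2.2])
  exact one_ne_zero h3.1

/-- A function on the plane with zero derivative along the direction orthogonal to `a` depends
on `inner a x` only. -/
theorem eq_comp_inner_of_hasDerivAt_zero {a : EuclideanSpace ℝ (Fin 2)} (ha : a ≠ 0)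
    {F : EuclideanSpace ℝ (Fin 2) → ℝ}
    (hF : ∀ x t, HasDerivAt (fun t : ℝ => F (x + t • planePerp a)) 0 t)
    (x : EuclideanSpace ℝ (Fin 2)) : F x = F ((inner ℝ a x * (inner ℝ a a)⁻¹) • a) := by
  have hn : inner ℝ a a ≠ 0 := inner_self_ne_zero.2 ha
  have hx : x = (inner ℝ a x * (inner ℝ a a)⁻¹) • a +
      (inner ℝ (planePerp a) x * (inner ℝ a a)⁻¹) • planePerp a := by
    rw [real_inner_plane] at hn
    have hn1 : a 0 ^ 2 + a 1 ^ 2 ≠ 0 := by simpa only [sq] using hn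
    have hn2 : a 1 ^ 2 + a 0 ^ 2 ≠ 0 := by rwa [add_comm]
    simp only [real_inner_plane, ← sq]
    ext i
    fin_cases i <;> simp [planePerp] <;> field_simp <;> ring
  have hc := is_const_of_deriv_eq_zero (fun t => (hF ((inner ℝ a x * (inner ℝ a a)⁻¹) • a) t
    ).differentiableAt) (fun t => (hF _ t).deriv)
    (inner ℝ (planePerp a) x * (inner ℝ a a)⁻¹) 0
  rw [← hx, zero_smul, add_zero] at hc
  exact hc

theorem hasDerivAt_ridge_line {n : ℕ} {a e : EuclideanSpace ℝ (Fin n)} {G H : ℝ → ℝ}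
    (hG : ∀ u, HasDerivAt G (H u) u) (h : inner ℝ a e ≠ 0) (x : EuclideanSpace ℝ (Fin n))
    (t : ℝ) :
    HasDerivAt (fun t : ℝ => (inner ℝ a e)⁻¹ * G (inner ℝ a (x + t • e)))
      (H (inner ℝ a (x + t • e))) t := by
  have h1 : HasDerivAt (fun t : ℝ => inner ℝ a (x + t • e)) (inner ℝ a e) t := by
    simp only [inner_add_right, inner_smul_right]
    simpa using ((hasDerivAt_id t).mul_const (inner ℝ a e)).const_add (inner ℝ a x)
  refine (((hG _).comp t h1).const_mul (inner ℝ a e)⁻¹).congr_deriv ?_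
  field_simp

theorem ContDiff.exists_hasDerivAt {H : ℝ → ℝ} {s : ℕ} (hH : ContDiff ℝ s H) :
    ∃ G : ℝ → ℝ, ContDiff ℝ s G ∧ ∀ u, HasDerivAt G (H u) u := by
  have hG (u : ℝ) : HasDerivAt (fun t => ∫ v in (0 : ℝ)..t, H v) (H u) u :=
    (hH.continuous.integral_hasStrictDerivAt 0 u).hasDerivAt
  refine ⟨_, ?_, hG⟩
  have : ContDiff ℝ (s + 1 : ℕ) fun t => ∫ v in (0 : ℝ)..t, H v := by
    push_cast
    refine contDiff_succ_iff_deriv.2 ⟨fun u => (hG u).differentiableAt, by simp, ?_⟩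
    rwa [show deriv (fun t => ∫ v in (0 : ℝ)..t, H v) = H from funext fun u => (hG u).deriv]
  exact this.of_le (by exact_mod_cast s.le_succ)

theorem AnnihilatedByDifferences.exists_contDiff_ridgeSum {s k : ℕ}
    {a : Fin k → EuclideanSpace ℝ (Fin 2)} (ha0 : ∀ i, a i ≠ 0)
    (ha : ∀ i j, i ≠ j → inner ℝ (a i) (planePerp (a j)) ≠ 0)
    {f : EuclideanSpace ℝ (Fin 2) → ℝ} (hf : ContDiff ℝ s f)
    (h : AnnihilatedByDifferences (List.ofFn fun i => planePerp (a i)) f) :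
    ∃ g : Fin k → ℝ → ℝ, (∀ i, ContDiff ℝ s (g i)) ∧ ∀ x, f x = ridgeSum a g x := by
  induction k generalizing f with
  | zero => exact ⟨fun _ => 0, fun i => i.elim0, fun x => by simpa [ridgeSum] using h x⟩
  | succ k ih =>
    rw [List.ofFn_succ] at h
    set e := planePerp (a 0)
    have hfc := hf.continuous
    have hA := hf.segmentAverage e
    have ih' {f : EuclideanSpace ℝ (Fin 2) → ℝ} := ih (a := fun i => a i.succ) (f := f)
      (fun i => ha0 _) (fun i j hij => ha _ _ (by simpa using hij))
    have he (i : Fin k) : inner ℝ (a i.succ) e ≠ 0 := ha _ _ (Fin.succ_ne_zero i)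
    obtain ⟨g, hg, hfg⟩ := ih' (f := fun x => f x - segmentAverage e f x) (hf.sub hA) <| by
      refine (congrArg (AnnihilatedByDifferences _) (funext fun x => ?_)).mp
        (AnnihilatedByDifferences.intervalIntegral (f := fun u x => f (x + u • e) - f x)
          (by unfold Function.uncurry; fun_prop) h 0 1).neg
      have hc : Continuous fun u : ℝ => f (x + u • e) := by fun_prop
      rw [intervalIntegral.integral_sub (hc.intervalIntegrable _ _) intervalIntegrable_const]
      simp [segmentAverage]
    obtain ⟨H, hH, hfH⟩ := ih' (f := fun x => f (x + (1 : ℝ) • e) - f x)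
      ((hf.comp (contDiff_id.add contDiff_const)).sub hf) (h 1)
    choose G hG hGH using fun i => (hH i).exists_hasDerivAt
    set Q : EuclideanSpace ℝ (Fin 2) → ℝ := fun x =>
      segmentAverage e f x - ∑ i : Fin k, (inner ℝ (a i.succ) e)⁻¹ * G i (inner ℝ (a i.succ) x)
      with hQ
    have hQs : ContDiff ℝ s Q := by
      refine hA.sub (ContDiff.sum fun i _ => contDiff_const.mul ((hG i).comp ?_))
      exact contDiff_const.inner ℝ contDiff_id
    have hQ0 (x : EuclideanSpace ℝ (Fin 2)) (t : ℝ) :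
        HasDerivAt (fun t : ℝ => Q (x + t • e)) 0 t := by
      have := (hasDerivAt_segmentAverage_line e hfc x t).fun_sub
        (HasDerivAt.fun_sum (u := Finset.univ) fun i _ =>
          hasDerivAt_ridge_line (hGH i) (he i) x t)
      exact this.congr_deriv (sub_eq_zero.2 (hfH (x + t • e)))
    refine ⟨Fin.cons (fun t => Q ((t * (inner ℝ (a 0) (a 0))⁻¹) • a 0))
      fun i t => g i t + (inner ℝ (a i.succ) e)⁻¹ * G i t, ?_, fun x => ?_⟩
    · refine Fin.cases ?_ fun i => ?_
      · exact hQs.comp (by fun_prop)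
      · exact (hg i).add (contDiff_const.mul (hG i))
    · have h1 := hfg x
      have h2 := eq_comp_inner_of_hasDerivAt_zero (ha0 0) hQ0 x
      simp only [ridgeSum, Fin.sum_univ_succ, Fin.cons_zero, Fin.cons_succ,
        Finset.sum_add_distrib, ← h2] at h1 ⊢
      rw [← h1, hQ]
      ring

theorem MvPolynomial.totalDegree_pderiv_le {σ R : Type*} [CommSemiring R] (i : σ)
    (P : MvPolynomial σ R) : (MvPolynomial.pderiv i P).totalDegree ≤ P.totalDegree - 1 := by
  refine Finset.sup_le fun m hm => ?_
  rw [MvPolynomial.mem_support_iff, MvPolynomial.coeff_pderiv] at hm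
  have := MvPolynomial.le_totalDegree (MvPolynomial.mem_support_iff.2 (left_ne_zero_of_mul hm))
  rw [Finsupp.sum_add_index' (by simp) (by simp), Finsupp.sum_single_index rfl] at this
  omega

theorem MvPolynomial.hasDerivAt_eval_line {σ : Type*} [Fintype σ] (P : MvPolynomial σ ℝ)
    (x e : σ → ℝ) (t : ℝ) :
    HasDerivAt (fun t : ℝ => MvPolynomial.eval (x + t • e) P)
      (MvPolynomial.eval (x + t • e) (∑ i, MvPolynomial.C (e i) * MvPolynomial.pderiv i P)) t := by
  classical
  induction P using MvPolynomial.induction_on with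
  | C r => simpa using hasDerivAt_const t r
  | add p q hp hq => simpa [mul_add, Finset.sum_add_distrib] using hp.fun_add hq
  | mul_X p j hp =>
    have hX : HasDerivAt (fun t : ℝ => (x + t • e) j) (e j) t := by
      simpa using ((hasDerivAt_id t).mul_const (e j)).const_add (x j)
    have := hp.fun_mul hX
    simp only [map_mul, MvPolynomial.eval_X]
    refine this.congr_deriv ?_
    simp only [map_sum, MvPolynomial.eval_mul, MvPolynomial.eval_C, Derivation.leibniz,
      MvPolynomial.pderiv_X, smul_eq_mul, MvPolynomial.eval_add, MvPolynomial.eval_X, mul_add,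
      Finset.sum_add_distrib, Finset.sum_mul]
    rw [add_comm]
    symm
    congr 1
    · rw [Finset.sum_eq_single j (fun i _ hij => by simp [hij.symm])
        (by simp)]
      simp [mul_comm]
    · exact Finset.sum_congr rfl fun i _ => by ring

theorem Polynomial.exists_derivative_eq {n : ℕ} (p : ℝ[X]) (hp : p.natDegree ≤ n) :
    ∃ q : ℝ[X], q.natDegree ≤ n + 1 ∧ Polynomial.derivative q = p := by
  refine ⟨∑ i ∈ Finset.range (n + 1), Polynomial.monomial (i + 1) (p.coeff i / (i + 1)),
    Polynomial.natDegree_sum_le_of_forall_le _ _ fun i hi => ?_, ?_⟩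
  · exact (Polynomial.natDegree_monomial_le _).trans (by simpa using hi)
  · rw [Polynomial.derivative_sum]
    conv_rhs => rw [p.as_sum_range' (n + 1) (by omega)]
    refine Finset.sum_congr rfl fun i _ => ?_
    have : (i : ℝ) + 1 ≠ 0 := by positivity
    rw [Polynomial.derivative_monomial]
    simp [this]

theorem Polynomial.exists_eval_mul {n : ℕ} (p : ℝ[X]) (hp : p.natDegree ≤ n) (c : ℝ) :
    ∃ q : ℝ[X], q.natDegree ≤ n ∧ ∀ t, q.eval t = p.eval (t * c) := by
  refine ⟨p.comp (Polynomial.C c * Polynomial.X), Polynomial.natDegree_comp_le.trans ?_,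
    fun t => by simp only [Polynomial.eval_comp, Polynomial.eval_mul, Polynomial.eval_C,
      Polynomial.eval_X, mul_comm]⟩
  have : (Polynomial.C c * Polynomial.X : ℝ[X]).natDegree ≤ 1 := by compute_degree
  simpa using Nat.mul_le_mul hp this

theorem MvPolynomial.exists_polynomial_eval_smul {σ : Type*} {n : ℕ} (P : MvPolynomial σ ℝ)
    (hP : P.totalDegree ≤ n) (v : σ → ℝ) :
    ∃ q : ℝ[X], q.natDegree ≤ n ∧ ∀ t, q.eval t = MvPolynomial.eval (t • v) P := by
  refine ⟨MvPolynomial.aeval (fun j => Polynomial.C (v j) * Polynomial.X) P, ?_, fun t => ?_⟩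
  · have := MvPolynomial.aeval_natDegree_le (n := 1) P hP
      (fun j => (Polynomial.C (v j) * Polynomial.X : ℝ[X])) fun j => by compute_degree
    rwa [mul_one] at this
  · rw [← Polynomial.coe_evalRingHom, MvPolynomial.aeval_def, MvPolynomial.eval₂_comp_left,
      MvPolynomial.eval, MvPolynomial.coe_eval₂Hom]
    congr 1
    · ext; simp
    · ext j; simpa using mul_comm _ _

theorem MvPolynomial.exists_polynomial_ridgeSum {k : ℕ}
    {a : Fin (k + 1) → EuclideanSpace ℝ (Fin 2)}
    (ha : ∀ i j, i ≠ j → LinearIndependent ℝ ![a i, a j])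
    (P : MvPolynomial (Fin 2) ℝ) (hP : P.totalDegree ≤ k) :
    ∃ p : Fin (k + 1) → ℝ[X], (∀ i, (p i).natDegree ≤ k) ∧
      ∀ x : EuclideanSpace ℝ (Fin 2),
        MvPolynomial.eval (fun j => x j) P = ridgeSum a (fun i t => (p i).eval t) x := by
  induction k generalizing P with
  | zero =>
    rw [MvPolynomial.totalDegree_eq_zero_iff_eq_C.1 (Nat.le_zero.1 hP)]
    exact ⟨fun _ => Polynomial.C (P.coeff 0), by simp, by simp [ridgeSum]⟩
  | succ k ih =>
    set e := planePerp (a 0)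
    set n := inner ℝ (a 0) (a 0)
    have ha0 : a 0 ≠ 0 := (ha 0 1 (by simp)).ne_zero 0
    have he (i : Fin (k + 1)) : inner ℝ (a i.succ) e ≠ 0 :=
      inner_planePerp_ne_zero (ha _ _ (Fin.succ_ne_zero i))
    obtain ⟨p, hp, hDp⟩ := ih (a := fun i => a i.succ) (fun i j hij => ha _ _ (by simpa using hij))
      (∑ i, MvPolynomial.C (e i) * MvPolynomial.pderiv i P) <| by
        refine MvPolynomial.totalDegree_finsetSum_le fun i _ => ?_
        rw [← MvPolynomial.smul_eq_C_mul]
        refine (MvPolynomial.totalDegree_smul_le _ _).trans ?_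
        exact (MvPolynomial.totalDegree_pderiv_le i P).trans (by omega)
    choose q hq hqp using fun i => (p i).exists_derivative_eq (hp i)
    set Q : EuclideanSpace ℝ (Fin 2) → ℝ := fun x => MvPolynomial.eval (fun j => x j) P -
      ∑ i : Fin (k + 1), (inner ℝ (a i.succ) e)⁻¹ * (q i).eval (inner ℝ (a i.succ) x) with hQ
    have hQ0 (x : EuclideanSpace ℝ (Fin 2)) (t : ℝ) : HasDerivAt (fun t : ℝ => Q (x + t • e)) 0 t := by
      have := (P.hasDerivAt_eval_line x e t).fun_sub
        (HasDerivAt.fun_sum (u := Finset.univ) fun i _ =>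
          hasDerivAt_ridge_line (fun u => (q i).hasDerivAt u) (he i) x t)
      simp only [hqp] at this
      exact this.congr_deriv (sub_eq_zero.2 (hDp (x + t • e)))
    obtain ⟨r, hr, hrP⟩ := P.exists_polynomial_eval_smul hP (fun j => n⁻¹ * a 0 j)
    choose w hw hwq using fun i =>
      (q i).exists_eval_mul (hq i) (n⁻¹ * inner ℝ (a i.succ) (a 0))
    refine ⟨Fin.cons (r - ∑ i : Fin (k + 1), Polynomial.C (inner ℝ (a i.succ) e)⁻¹ * w i)
      fun i => Polynomial.C (inner ℝ (a i.succ) e)⁻¹ * q i, ?_, fun x => ?_⟩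
    · refine Fin.cases ?_ fun i => ?_
      · refine (Polynomial.natDegree_sub_le _ _).trans (max_le hr ?_)
        exact Polynomial.natDegree_sum_le_of_forall_le _ _ fun i _ =>
          (Polynomial.natDegree_C_mul_le _ _).trans (hw i)
      · exact (Polynomial.natDegree_C_mul_le _ _).trans (hq i)
    · have h2 := eq_comp_inner_of_hasDerivAt_zero ha0 hQ0 x
      have h3 (t : ℝ) : r.eval t = MvPolynomial.eval (fun j => ((t * n⁻¹) • a 0) j) P := by
        rw [hrP]
        congr 2
        ext j
        simp [mul_assoc]
      have h4 (i : Fin (k + 1)) (t : ℝ) :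
          (w i).eval t = (q i).eval (inner ℝ (a i.succ) ((t * n⁻¹) • a 0)) := by
        rw [hwq, inner_smul_right, mul_assoc]
      rw [hQ, sub_eq_iff_eq_add] at h2
      simp only [ridgeSum, Fin.sum_univ_succ (n := k + 1), Fin.cons_zero, Fin.cons_succ]
      simp only [h2, Polynomial.eval_sub, h3, Polynomial.eval_finsetSum, Polynomial.eval_mul,
        Polynomial.eval_C, h4]
      rfl

theorem mainTheorem6 (k : ℕ) (hk : 1 ≤ k) (a : Fin k → EuclideanSpace ℝ (Fin 2))
    (ha : ∀ i j : Fin k, i ≠ j → LinearIndependent ℝ ![a i, a j]) :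
    (∀ (s : ℕ) (f : EuclideanSpace ℝ (Fin 2) → ℝ), ContDiff ℝ s f →
      (∃ φ : Fin k → ℝ → ℝ, ∀ x, f x = ridgeSum a φ x) →
      ∃ g : Fin k → ℝ → ℝ, (∀ i, ContDiff ℝ s (g i)) ∧ ∀ x, f x = ridgeSum a g x) ∧
    (∀ P : MvPolynomial (Fin 2) ℝ, P.totalDegree ≤ k - 1 →
      ∃ p : Fin k → ℝ[X], (∀ i, (p i).natDegree ≤ k - 1) ∧
        ∀ x : EuclideanSpace ℝ (Fin 2),
          MvPolynomial.eval (fun j => x j) P = ridgeSum a (fun i t => (p i).eval t) x) := by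
  obtain ⟨k, rfl⟩ : ∃ m, k = m + 1 := ⟨k - 1, by omega⟩
  refine ⟨fun s f hf ⟨φ, hφ⟩ => ?_, fun P hP => P.exists_polynomial_ridgeSum ha hP⟩
  by_cases ha0 : ∀ i, a i ≠ 0
  · refine AnnihilatedByDifferences.exists_contDiff_ridgeSum ha0
      (fun i j hij => inner_planePerp_ne_zero (ha i j hij)) hf ?_
    rw [show f = ridgeSum a φ from funext hφ]
    exact annihilatedByDifferences_ridgeSum a _ (fun i => inner_planePerp_self (a i)) φ
  · -- A zero direction is possible only when there is just one direction.
    push Not at ha0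
    obtain ⟨i, hi⟩ := ha0
    have hu (j : Fin (k + 1)) : j = i := by
      by_contra hij
      exact (ha i j (Ne.symm hij)).ne_zero 0 hi
    have hz (j : Fin (k + 1)) : a j = 0 := by rw [hu j, hi]
    exact ⟨fun j _ => φ j 0, fun j => contDiff_const, fun x => by simp [hφ, ridgeSum, hz]⟩
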